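/- Let $k\ge 1$ be an integer, let $n=5k$, and let $d=2^{4k}+2^{3k}+2^{2k}+2^{k}-1$ (the Dobbertin exponent on $\mathbb{F}_{2^{n}}$). A mapping $f:\mathbb{F}_{2^n}\to\mathbb{F}_{2^n}$ is called almost bent (AB) if $n$ is odd and, for all $\alpha,\beta\in\mathbb{F}_{2^n}$ with $\alpha\neq 0$, $$\sum_{x\in\mathbb{F}_{2^n}}(-1)^{\mathrm{Tr}(\alpha f(x)+\beta x)}\in\{0,\ 2^{\frac{n+1}{2}},\ -2^{\frac{n+1}{2}}\},$$ where $\mathrm{Tr}:\mathbb{F}_{2^n}\to\mathbb{F}_2$ is the absolute trace. Then: 1. the monomial mapping $x\mapsto x^{d}$ on $\mathbb{F}_{2^n}$ is not AB; 2. if $k$ is odd, then $d$ has an inverse modulo $2^{n}-1$, that is, there is an integer $e$ with $1\le e\le 2^n-2$ and $de\equiv 1 \pmod{2^{n}-1}$; 3. for every non-negative integer $e$ with $de\equiv 1\pmod{2^{n}-1}$, the monomial mapping $x\mapsto x^{e}$ on $\mathbb{F}_{2^n}$ is not AB. -/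

import Mathlib

/-- The Walsh coefficient `∑ x, (-1) ^ Tr (α f(x) + β x)` of a self-map `f` of a finite field of
characteristic 2, where `Tr` is the absolute trace (the trace to the prime field). -/
noncomputable def walshCoeff {F : Type*} [Field F] [Fintype F] [Algebra (ZMod 2) F]
    (f : F → F) (α β : F) : ℤ :=
  ∑ x : F, (-1 : ℤ) ^ (Algebra.trace (ZMod 2) F (α * f x + β * x)).val

/-- A self-map `f` of the field with `2 ^ n` elements (`n` being its degree over the prime field)
is almost bent if `n` is odd and all its Walsh coefficients at `(α, β)` with `α ≠ 0` lie in
`{0, 2 ^ ((n + 1) / 2), -2 ^ ((n + 1) / 2)}`. The division is exact since `n` is odd. -/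
def IsAlmostBent {F : Type*} [Field F] [Fintype F] [Algebra (ZMod 2) F] (f : F → F) : Prop :=
  Odd (Module.finrank (ZMod 2) F) ∧
    ∀ α β : F, α ≠ 0 →
      walshCoeff f α β = 0 ∨
      walshCoeff f α β = 2 ^ ((Module.finrank (ZMod 2) F + 1) / 2) ∨
      walshCoeff f α β = -2 ^ ((Module.finrank (ZMod 2) F + 1) / 2)

/-- The Dobbertin exponent for the field with `2 ^ (5 * k)` elements. -/
def dobbertinExponent (k : ℕ) : ℕ :=
  2 ^ (4 * k) + 2 ^ (3 * k) + 2 ^ (2 * k) + 2 ^ k - 1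

/-! An AB map requires `n` odd, so let `k = 2m + 1`. AB passes to compositional inverses, so it
suffices that the inverse power map `x ^ e` is not AB. Divisibility of Walsh coefficients forces the
derivatives of order `(n + 3) / 2` of an AB map to vanish (`IsAlmostBent.sum_subset_sums_eq_zero`),
whereas `e` has binary weight exactly `(n + 3) / 2 = 5m + 4`. For such a power map, that derivative
at `0` in directions `v i` is the determinant of the matrix `v i ^ 2 ^ j` (Ryser's formula), which
is nonzero for some `v` because distinct characters are independent. -/

section CharTwoDeterminant

open Finset

variable {R ι : Type*} [CommRing R] [CharP R 2] [Fintype ι] [DecidableEq ι]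

/-- Ryser's formula in characteristic two, where the permanent is the determinant. -/
theorem Matrix.det_eq_sum_prod_sum_of_charTwo (M : Matrix ι ι R) :
    M.det = ∑ c : Finset ι, ∏ j, ∑ i ∈ c, M i j := by
  have hexp (c : Finset ι) :
      ∏ j, ∑ i ∈ c, M i j =
        ∑ p : ι → ι, if univ.image p ⊆ c then ∏ j, M (p j) j else 0 := by
    rw [prod_univ_sum, ← sum_filter]
    refine sum_congr ?_ fun _ _ ↦ rfl
    ext p
    simp [Fintype.mem_piFinset, image_subset_iff]
  have hcount (p : ι → ι) (hp : ¬ Function.Bijective p) :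
      (∑ c : Finset ι, if univ.image p ⊆ c then ∏ j, M (p j) j else 0) = 0 := by
    rw [← Finite.surjective_iff_bijective] at hp
    simp only [Function.Surjective, not_forall, not_exists] at hp
    obtain ⟨b, hb⟩ := hp
    -- Toggling a point `b` missed by `p` pairs off the subsets containing the image, and equal
    -- terms cancel in characteristic two.
    have hb' (x : Finset ι) : univ.image p ⊆ symmDiff x {b} ↔ univ.image p ⊆ x := by
      simp only [image_subset_iff, mem_univ, forall_const, mem_symmDiff, mem_singleton, hb]
      simp
    refine sum_involution (fun c _ ↦ symmDiff c {b}) ?_ ?_ ?_ ?_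
    · intro c _
      simp only [hb']
      exact CharTwo.add_self_eq_zero _
    · intro c _ _ h
      simp at h
    · simp
    · intro c _
      simp
  have hperm (p : Equiv.Perm ι) :
      (∑ c : Finset ι, if univ.image p ⊆ c then ∏ j, M (p j) j else 0) = ∏ j, M (p j) j := by
    rw [sum_eq_single univ] <;> simp +contextual [image_univ_of_surjective p.surjective]
  simp_rw [hexp]
  rw [sum_comm, ← sum_filter_add_sum_filter_not univ (fun p : ι → ι ↦ Function.Bijective p),
    sum_eq_zero (s := univ.filter fun p : ι → ι ↦ ¬ Function.Bijective p)
      (fun p hp ↦ hcount p (mem_filter.1 hp).2), add_zero, Matrix.det_apply]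
  refine sum_bij (fun p _ ↦ (p : ι → ι)) ?_ ?_ ?_ ?_
  · intro p _
    simp
  · intro p _ q _ h
    exact DFunLike.coe_injective h
  · intro p hp
    exact ⟨Equiv.ofBijective p (mem_filter.1 hp).2, mem_univ _, rfl⟩
  · intro p _
    rw [hperm]
    rcases Int.units_eq_one_or (Equiv.Perm.sign p) with h | h <;> simp [h, CharTwo.neg_eq]

end CharTwoDeterminant

/-- Linearly independent functions have a nonsingular evaluation matrix. -/
theorem LinearIndependent.exists_det_ne_zero {K X ι : Type*} [Field K] [Fintype ι] [DecidableEq ι]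
    {φ : ι → X → K} (hφ : LinearIndependent K φ) :
    ∃ v : ι → X, (Matrix.of fun i j ↦ φ j (v i)).det ≠ 0 := by
  set ev : X → ι → K := fun x j ↦ φ j x
  have hspan : Submodule.span K (Set.range ev) = ⊤ := by
    by_contra h
    -- A functional vanishing on all evaluation vectors is a linear relation among the `φ j`.
    obtain ⟨f, hf, hf'⟩ := Submodule.exists_le_ker_of_lt_top _ (lt_top_iff_ne_top.2 h)
    apply hf
    have hs (j : ι) : (Pi.single j 1 : ι → K) = fun i ↦ if j = i then 1 else 0 := by
      ext i
      simp [Pi.single_apply, eq_comm]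
    have hsum : ∑ j, f (Pi.single j 1) • φ j = 0 := by
      ext x
      have := hf' (Submodule.subset_span ⟨x, rfl⟩)
      rw [LinearMap.mem_ker, LinearMap.pi_apply_eq_sum_univ] at this
      simpa [hs, ev, mul_comm] using this
    have hzero := Fintype.linearIndependent_iff.1 hφ _ hsum
    refine LinearMap.pi_ext' fun j ↦ LinearMap.ext_ring ?_
    simpa using hzero j
  obtain ⟨f, hf, -, hind⟩ := Submodule.exists_fun_fin_finrank_span_eq K (Set.range ev)
  have hcard : Module.finrank K (Submodule.span K (Set.range ev)) = Fintype.card ι := by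
    rw [hspan]; simp
  let e : ι ≃ Fin (Module.finrank K (Submodule.span K (Set.range ev))) :=
    Fintype.equivFinOfCardEq hcard.symm
  choose v hv using fun i ↦ hf (e i)
  refine ⟨v, ?_⟩
  have hrows : LinearIndependent K (Matrix.of fun i j ↦ φ j (v i)).row := by
    have : (Matrix.of fun i j ↦ φ j (v i)).row = f ∘ e := funext fun i ↦ hv i
    rw [this]
    exact hind.comp _ e.injective
  exact ((Matrix.isUnit_iff_isUnit_det _).1
    (Matrix.linearIndependent_rows_iff_isUnit.1 hrows)).ne_zero

section BinaryWeight

/-- `e` is a sum of `w` distinct powers `2 ^ j` with `j < n`. -/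
def HasBinaryWeight (e n w : ℕ) : Prop :=
  ∃ S : Finset ℕ, S ⊆ Finset.range n ∧ S.card = w ∧ ∑ j ∈ S, 2 ^ j = e

theorem hasBinaryWeight_zero (n : ℕ) : HasBinaryWeight 0 n 0 := ⟨∅, by simp⟩

theorem hasBinaryWeight_one : HasBinaryWeight 1 1 1 := ⟨{0}, by simp⟩

/-- Juxtaposes binary words, with `a` as the low `m` bits. -/
theorem HasBinaryWeight.concat {a b m n v w : ℕ} (ha : HasBinaryWeight a m v)
    (hb : HasBinaryWeight b n w) : HasBinaryWeight (a + 2 ^ m * b) (m + n) (v + w) := by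
  obtain ⟨S, hS, rfl, rfl⟩ := ha
  obtain ⟨T, hT, rfl, rfl⟩ := hb
  have hdisj : Disjoint S (T.map (addLeftEmbedding m)) := by
    rw [Finset.disjoint_left]
    intro x hx hx'
    obtain ⟨y, -, rfl⟩ := Finset.mem_map.1 hx'
    have := Finset.mem_range.1 (hS hx)
    simp at this
  refine ⟨S ∪ T.map (addLeftEmbedding m), ?_, ?_, ?_⟩
  · intro x hx
    rw [Finset.mem_union, Finset.mem_map] at hx
    rw [Finset.mem_range]
    rcases hx with hx | ⟨y, hy, rfl⟩
    · have := Finset.mem_range.1 (hS hx)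
      omega
    · have := Finset.mem_range.1 (hT hy)
      simpa using this
  · rw [Finset.card_union_of_disjoint hdisj, Finset.card_map]
  · rw [Finset.sum_union hdisj, Finset.sum_map, Finset.mul_sum]
    simp [pow_add]

/-- The binary expansion of `2 (4 ^ m - 1) / 3`. -/
theorem exists_hasBinaryWeight_alternating (m : ℕ) :
    ∃ a, 3 * a + 1 = 4 ^ m ∧ HasBinaryWeight (2 * a) (2 * m) m := by
  induction m with
  | zero => exact ⟨0, by simp, hasBinaryWeight_zero 0⟩
  | succ m ih =>
    obtain ⟨a, ha, h⟩ := ih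
    refine ⟨1 + 4 * a, by rw [pow_succ]; omega, ?_⟩
    have := ((hasBinaryWeight_zero 1).concat hasBinaryWeight_one).concat h
    convert this using 1 <;> ring

end BinaryWeight

section InverseExponent

/-- The binary expansion of the inverse of the Dobbertin exponent modulo `2 ^ (5 * k) - 1`. -/
theorem exists_dobbertinExponent_inverse (m : ℕ) :
    ∃ e, 1 ≤ e ∧ e ≤ 2 ^ (5 * (2 * m + 1)) - 2 ∧
      dobbertinExponent (2 * m + 1) * e ≡ 1 [MOD 2 ^ (5 * (2 * m + 1)) - 1] ∧
      HasBinaryWeight e (5 * (2 * m + 1)) (5 * m + 4) := by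
  obtain ⟨a, ha, hw⟩ := exists_hasBinaryWeight_alternating m
  have hp : 2 ^ (2 * m) = 3 * a + 1 := by rw [pow_mul, ha]; norm_num
  have hq : 2 ^ (2 * m + 1) = 6 * a + 2 := by rw [pow_succ, hp]; ring
  have hqi (i : ℕ) : 2 ^ (i * (2 * m + 1)) = (6 * a + 2) ^ i := by rw [mul_comm, pow_mul, hq]
  have hs : HasBinaryWeight (2 * a) (2 * m + 1) m := by
    simpa using hw.concat (hasBinaryWeight_zero 1)
  have ht : HasBinaryWeight (5 * a + 1) (2 * m + 1) (m + 1) := by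
    convert hw.concat hasBinaryWeight_one using 1
    rw [hp]; ring
  have hpos : 1 ≤ (6 * a + 2) ^ 5 := Nat.one_le_pow _ _ (by omega)
  -- Let `q = 2 ^ k = 6a + 2` and `Q = 1 + q + ⋯ + q ^ 4`. Then `d = Q - 2`, `Q * e ≡ (22a + 4) * Q`
  -- and `2e = (10a + 2) * Q - q ^ 5`, so `d * e ≡ 2 * (q - 1) * Q + q ^ 5 ≡ 1` modulo `q ^ 5 - 1`.
  refine ⟨(5 * a + 1) * (1 + (6 * a + 2) + (6 * a + 2) ^ 2 + (6 * a + 2) ^ 3) +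
    2 * a * (6 * a + 2) ^ 4, ?_, ?_, ?_, ?_⟩
  · nlinarith [Nat.zero_le (2 * a * (6 * a + 2) ^ 4)]
  · rw [hqi]
    apply Nat.le_sub_of_add_le
    ring_nf
    nlinarith [Nat.zero_le a]
  · rw [dobbertinExponent, hqi, hqi, hqi, hqi, hq, Nat.modEq_iff_dvd]
    have h1 : 1 ≤ (6 * a + 2) ^ 4 + (6 * a + 2) ^ 3 + (6 * a + 2) ^ 2 + (6 * a + 2) := by omega
    push_cast [Nat.cast_sub h1, Nat.cast_sub hpos]
    refine ⟨-(3 + (5 * a + 1) * ((6 * a + 2) ^ 3 + 2 * (6 * a + 2) ^ 2 + 3 * (6 * a + 2) + 4) -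
      (3 * a + 1) * ((6 * a + 2) ^ 3 + (6 * a + 2) ^ 2 + (6 * a + 2) + 1)), ?_⟩
    ring
  · convert ht.concat (ht.concat (ht.concat (ht.concat hs))) using 1
    · rw [hq]; ring
    · ring
    · ring

end InverseExponent

section Walsh

open Finset

variable {F : Type*} [Field F] [Fintype F] [Algebra (ZMod 2) F]

theorem neg_one_pow_val_add (a b : ZMod 2) :
    (-1 : ℤ) ^ (a + b).val = (-1) ^ a.val * (-1) ^ b.val := by
  revert a b; decide

variable (F) in
/-- The canonical additive character `x ↦ (-1) ^ Tr x`. -/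
noncomputable def signChar : AddChar F ℤ where
  toFun x := (-1) ^ (Algebra.trace (ZMod 2) F x).val
  map_zero_eq_one' := by simp
  map_add_eq_mul' x y := by rw [map_add, neg_one_pow_val_add]

omit [Fintype F] in
theorem signChar_apply (x : F) : signChar F x = (-1) ^ (Algebra.trace (ZMod 2) F x).val := rfl

theorem walshCoeff_eq_sum_signChar (f : F → F) (α β : F) :
    walshCoeff f α β = ∑ x, signChar F (α * f x + β * x) := rfl

theorem exists_trace_mul_ne_zero {a : F} (ha : a ≠ 0) :
    ∃ b, Algebra.trace (ZMod 2) F (a * b) ≠ 0 := by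
  obtain ⟨x, hx⟩ := Algebra.trace_surjective (ZMod 2) F 1
  refine ⟨a⁻¹ * x, ?_⟩
  rw [mul_inv_cancel_left₀ ha, hx]
  exact one_ne_zero

theorem sum_signChar_mul {a : F} (ha : a ≠ 0) : ∑ x, signChar F (a * x) = 0 := by
  have hne : (signChar F).mulShift a ≠ 1 := by
    intro h
    obtain ⟨b, hb⟩ := exists_trace_mul_ne_zero ha
    have := DFunLike.congr_fun h b
    rw [AddChar.mulShift_apply, signChar_apply, AddChar.one_apply] at this
    revert this hb
    generalize Algebra.trace (ZMod 2) F (a * b) = t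
    revert t
    decide
  simpa using AddChar.sum_eq_zero_of_ne_one hne

theorem sum_signChar_mul_eq_ite [DecidableEq F] (a : F) :
    ∑ x, signChar F (a * x) = if a = 0 then (Fintype.card F : ℤ) else 0 := by
  split_ifs with h
  · simp [h]
  · exact sum_signChar_mul h

/-- The compositional inverse of an almost bent permutation is almost bent. -/
theorem IsAlmostBent.of_inverse {f g : F → F} (hf : IsAlmostBent f)
    (hgf : Function.LeftInverse g f) (hfg : Function.RightInverse g f) : IsAlmostBent g := by
  refine ⟨hf.1, fun α β hα ↦ ?_⟩
  have hswap : walshCoeff g α β = walshCoeff f β α := by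
    rw [walshCoeff_eq_sum_signChar, walshCoeff_eq_sum_signChar]
    refine (Fintype.sum_equiv (⟨f, g, hgf, hfg⟩ : F ≃ F) _ _ fun x ↦ ?_).symm
    simp only [Equiv.coe_fn_mk]
    rw [hgf x, add_comm]
  rw [hswap]
  -- The swap puts `β` in the slot that must be nonzero for `hf` to apply.
  by_cases hβ : β = 0
  · left
    simpa [walshCoeff_eq_sum_signChar, hβ] using sum_signChar_mul hα
  · exact hf.2 β α hβ

/-- Poisson summation over the subset sums of a family of vectors. -/
theorem card_mul_sum_signChar_subset_sums {ι : Type*} [Fintype ι] [DecidableEq ι] (f : F → F)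
    (α : F) (v : ι → F) :
    (Fintype.card F : ℤ) * ∑ c : Finset ι, signChar F (α * f (∑ i ∈ c, v i)) =
      ∑ β, walshCoeff f α β * ∏ i, (1 + signChar F (β * v i)) := by
  classical
  have hprod (β : F) : ∏ i, (1 + signChar F (β * v i)) =
      ∑ c : Finset ι, signChar F (β * ∑ i ∈ c, v i) := by
    rw [prod_one_add, powerset_univ]
    refine sum_congr rfl fun c _ ↦ ?_
    rw [mul_sum]
    exact (map_prod (signChar F).toMonoidHom _ _).symm
  have := charP_of_injective_algebraMap (algebraMap (ZMod 2) F).injective 2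
  have hinv (y : F) : ∑ β, walshCoeff f α β * signChar F (β * y) =
      Fintype.card F * signChar F (α * f y) := by
    calc _ = ∑ β, ∑ x, signChar F (α * f x) * signChar F ((x + y) * β) := by
          refine sum_congr rfl fun β _ ↦ ?_
          rw [walshCoeff_eq_sum_signChar, sum_mul]
          refine sum_congr rfl fun x _ ↦ ?_
          rw [← AddChar.map_add_eq_mul, ← AddChar.map_add_eq_mul]
          ring_nf
      _ = _ := by
          rw [sum_comm]
          simp_rw [← mul_sum, sum_signChar_mul_eq_ite, CharTwo.add_eq_zero]
          simp [mul_comm]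
  simp_rw [hprod]
  rw [mul_sum]
  simp_rw [mul_sum (s := (univ : Finset (Finset ι)))]
  rw [sum_comm]
  exact sum_congr rfl fun c _ ↦ (hinv _).symm

omit [Fintype F] in
theorem two_pow_dvd_prod_one_add_signChar {ι : Type*} [Fintype ι] (v : ι → F) (β : F) :
    (2 : ℤ) ^ Fintype.card ι ∣ ∏ i, (1 + signChar F (β * v i)) := by
  rw [← card_univ, ← prod_const]
  refine prod_dvd_prod_of_dvd _ _ fun i _ ↦ ?_
  rw [signChar_apply]
  rcases neg_one_pow_eq_or ℤ (Algebra.trace (ZMod 2) F (β * v i)).val with h | h <;> simp [h]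

omit [Fintype F] in
theorem signChar_eq_one_sub (x : F) :
    signChar F x = 1 - 2 * ((Algebra.trace (ZMod 2) F x).val : ℤ) := by
  rw [signChar_apply]
  generalize Algebra.trace (ZMod 2) F x = t
  revert t; decide

/-- An almost bent map has degree at most `(n + 1) / 2`: its derivatives of order
`(n + 3) / 2` vanish. -/
theorem IsAlmostBent.sum_subset_sums_eq_zero {f : F → F} (hf : IsAlmostBent f) {ι : Type*}
    [Fintype ι] [DecidableEq ι] {n : ℕ} (hn : 1 < n) (hcard : Fintype.card F = 2 ^ n)
    (hι : 2 * Fintype.card ι = n + 3) (v : ι → F) :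
    ∑ c : Finset ι, f (∑ i ∈ c, v i) = 0 := by
  have hfin : Module.finrank (ZMod 2) F = n := by
    have := Module.card_eq_pow_finrank (K := ZMod 2) (V := F)
    rw [hcard, ZMod.card] at this
    exact (Nat.pow_right_injective le_rfl this).symm
  set r := Fintype.card ι
  have hr : 2 ≤ r := by omega
  -- Each Poisson term is divisible by `2 ^ (r - 1) * 2 ^ r = 2 ^ (n + 2)`; dividing by the field
  -- size `2 ^ n` leaves `4`.
  have hdvd (α : F) (hα : α ≠ 0) :
      (2 : ℤ) ^ 2 ∣ ∑ c : Finset ι, signChar F (α * f (∑ i ∈ c, v i)) := by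
    have hw (β : F) : (2 : ℤ) ^ (r - 1) ∣ walshCoeff f α β := by
      have hexp : (Module.finrank (ZMod 2) F + 1) / 2 = r - 1 := by omega
      have := hf.2 α β hα
      rw [hexp] at this
      rcases this with h | h | h <;> rw [h] <;> simp
    have hsum : (2 : ℤ) ^ (r - 1) * 2 ^ r ∣
        ∑ β, walshCoeff f α β * ∏ i, (1 + signChar F (β * v i)) :=
      dvd_sum fun β _ ↦ mul_dvd_mul (hw β) (two_pow_dvd_prod_one_add_signChar v β)
    rw [← card_mul_sum_signChar_subset_sums, hcard, ← pow_add,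
      show r - 1 + r = n + 2 by omega, pow_add] at hsum
    push_cast at hsum
    exact Int.dvd_of_mul_dvd_mul_left (by positivity) hsum
  have htr (α : F) (hα : α ≠ 0) :
      Algebra.trace (ZMod 2) F (α * ∑ c : Finset ι, f (∑ i ∈ c, v i)) = 0 := by
    have h := hdvd α hα
    -- The sum is `2 ^ r` minus twice the sum of the trace bits, and `4` divides `2 ^ r`, so the
    -- latter sum is even.
    simp_rw [signChar_eq_one_sub] at h
    rw [sum_sub_distrib, ← mul_sum, sum_const, card_univ, Fintype.card_finset, nsmul_one] at h
    have h4 : (2 : ℤ) ^ 2 ∣ ((2 ^ Fintype.card ι : ℕ) : ℤ) := by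
      push_cast
      exact pow_dvd_pow 2 hr
    have h2 := (dvd_sub_right h4).1 h
    rw [sq] at h2
    have h3 := Int.dvd_of_mul_dvd_mul_left (by norm_num) h2
    have h5 := (ZMod.intCast_zmod_eq_zero_iff_dvd _ 2).2 h3
    rw [mul_sum, map_sum]
    simpa using h5
  by_contra hne
  obtain ⟨b, hb⟩ := exists_trace_mul_ne_zero hne
  refine hb ?_
  rw [mul_comm]
  refine htr b ?_
  rintro rfl
  simp at hb

omit [Algebra (ZMod 2) F] in
theorem linearIndependent_pow_two_pow {n : ℕ} (hn : 1 < n) (hcard : Fintype.card F = 2 ^ n)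
    {S : Finset ℕ} (hS : S ⊆ range n) :
    LinearIndependent F fun (j : S) (x : F) ↦ x ^ 2 ^ (j : ℕ) := by
  have hinj : Function.Injective fun j : S ↦ (powMonoidHom (2 ^ (j : ℕ)) : F →* F) := by
    classical
    intro i j hij
    obtain ⟨g, hg⟩ := IsCyclic.exists_generator (α := Fˣ)
    have hord : orderOf g = 2 ^ n - 1 := by
      rw [orderOf_eq_card_of_forall_mem_zpowers hg, Nat.card_eq_fintype_card,
        Fintype.card_units, hcard]
    have hlt (j : S) : 2 ^ (j : ℕ) < orderOf g := by
      have hj := mem_range.1 (hS j.2)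
      have h1 : 2 ^ ((j : ℕ) + 1) ≤ 2 ^ n := Nat.pow_le_pow_right (by norm_num) hj
      have h2 : 2 ^ 2 ≤ 2 ^ n := Nat.pow_le_pow_right (by norm_num) hn
      rw [pow_succ] at h1
      rw [hord]
      omega
    have hpow : g ^ 2 ^ (i : ℕ) = g ^ 2 ^ (j : ℕ) := by
      ext
      simpa using DFunLike.congr_fun hij (g : F)
    exact Subtype.ext (Nat.pow_right_injective le_rfl
      (pow_injOn_Iio_orderOf (hlt i) (hlt j) hpow))
  exact (linearIndependent_monoidHom F F).comp _ hinj

/-- A power map whose exponent has binary weight `(n + 3) / 2` is not almost bent. -/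
theorem not_isAlmostBent_pow_of_hasBinaryWeight {n e w : ℕ} (hn : 1 < n)
    (hcard : Fintype.card F = 2 ^ n) (he : HasBinaryWeight e n w) (hw : 2 * w = n + 3) :
    ¬ IsAlmostBent fun x : F ↦ x ^ e := by
  intro hab
  have := charP_of_injective_algebraMap (algebraMap (ZMod 2) F).injective 2
  obtain ⟨S, hS, rfl, rfl⟩ := he
  obtain ⟨v, hv⟩ := (linearIndependent_pow_two_pow hn hcard hS).exists_det_ne_zero
  apply hv
  rw [Matrix.det_eq_sum_prod_sum_of_charTwo,
    ← hab.sum_subset_sums_eq_zero (ι := S) hn hcard (by simpa using hw) v]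
  refine sum_congr rfl fun c _ ↦ ?_
  rw [← prod_pow_eq_pow_sum, ← prod_coe_sort S]
  refine prod_congr rfl fun j _ ↦ ?_
  rw [sum_pow_char_pow]
  rfl

omit [Algebra (ZMod 2) F] in
theorem pow_eq_self_of_modEq_one {N m : ℕ} (hN : 1 < N) (hcard : Fintype.card F = N + 1)
    (hm : m ≡ 1 [MOD N]) (x : F) : x ^ m = x := by
  by_cases hx : x = 0
  · have : m ≠ 0 := by
      rintro rfl
      rw [Nat.ModEq, Nat.zero_mod, Nat.mod_eq_of_lt hN] at hm
      omega
    rw [hx, zero_pow this]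
  · have h1 : x ^ N = 1 := by
      have := FiniteField.pow_card_sub_one_eq_one x hx
      rwa [hcard, Nat.add_sub_cancel] at this
    rw [← Nat.mod_add_div m N, hm, Nat.mod_eq_of_lt hN, pow_add, pow_mul, h1, one_pow, pow_one,
      mul_one]

theorem IsAlmostBent.pow_of_modEq {N d e : ℕ} (hN : 1 < N) (hcard : Fintype.card F = N + 1)
    (h : d * e ≡ 1 [MOD N]) (hd : IsAlmostBent fun x : F ↦ x ^ d) :
    IsAlmostBent fun x : F ↦ x ^ e := by
  refine hd.of_inverse (fun x ↦ ?_) fun x ↦ ?_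
  · simpa [← pow_mul] using pow_eq_self_of_modEq_one hN hcard h x
  · simpa [← pow_mul, mul_comm] using pow_eq_self_of_modEq_one hN hcard h x

end Walsh

theorem mainTheorem2 (k : ℕ) (hk : 1 ≤ k)
    (F : Type*) [Field F] [Fintype F] [Algebra (ZMod 2) F]
    (hF : Fintype.card F = 2 ^ (5 * k)) :
    ¬ IsAlmostBent (fun x : F => x ^ dobbertinExponent k) ∧
    (Odd k → ∃ e : ℕ, 1 ≤ e ∧ e ≤ 2 ^ (5 * k) - 2 ∧
      dobbertinExponent k * e ≡ 1 [MOD 2 ^ (5 * k) - 1]) ∧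
    (∀ e : ℕ, dobbertinExponent k * e ≡ 1 [MOD 2 ^ (5 * k) - 1] →
      ¬ IsAlmostBent (fun x : F => x ^ e)) := by
  have hpow : 2 ^ 2 ≤ 2 ^ (5 * k) := Nat.pow_le_pow_right (by norm_num) (by omega)
  have hN : 1 < 2 ^ (5 * k) - 1 := by omega
  have hcard : Fintype.card F = 2 ^ (5 * k) - 1 + 1 := by omega
  have hodd {f : F → F} (hf : IsAlmostBent f) : Odd k := by
    have hfin := Module.card_eq_pow_finrank (K := ZMod 2) (V := F)
    rw [hF, ZMod.card] at hfin
    have h := hf.1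
    rw [← Nat.pow_right_injective le_rfl hfin] at h
    exact (Nat.odd_mul.1 h).2
  have hmain : ¬ IsAlmostBent (fun x : F => x ^ dobbertinExponent k) := by
    intro hab
    obtain ⟨m, rfl⟩ := hodd hab
    obtain ⟨e, -, -, hmod, hw⟩ := exists_dobbertinExponent_inverse m
    exact not_isAlmostBent_pow_of_hasBinaryWeight (by omega) hF hw (by ring)
      (hab.pow_of_modEq hN hcard hmod)
  refine ⟨hmain, ?_, fun e he hab ↦ ?_⟩
  · rintro ⟨m, rfl⟩
    obtain ⟨e, h1, h2, h3, -⟩ := exists_dobbertinExponent_inverse m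
    exact ⟨e, h1, h2, h3⟩
  · exact hmain (hab.pow_of_modEq hN hcard (by rwa [mul_comm e]))
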